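/- Let $\mathbb{F}_q$ be a finite field of characteristic at least $5$, and let $K$ be a cubic extension of $\mathbb{F}_q(t)$. Let $\mathcal{O}_K$ be the integral closure of $\mathbb{F}_q[t]$ in $K$. Call $K$ a *simple cubic function field* if $\mathcal{O}_K^*$ has rank two and there are units $\varepsilon, \varepsilon + k \in \mathcal{O}_K^* \setminus \mathbb{F}_q^*$ with $k \in \mathbb{F}_q^*$. A *Shanks simple cubic function field* is a simple cubic function field that is Galois over $\mathbb{F}_q(t)$. We say that $K$ is defined by a polynomial $f$ if $f$ is irreducible over $\mathbb{F}_q(t)$ and $K = \mathbb{F}_q(t)(\varepsilon)$ for a root $\varepsilon$ of $f$. For a nonzero $\alpha = \sum_{i \ge m} a_i t^{-i}$ with $a_m \neq 0$ in the completion $\mathbb{F}_q\langle t^{-1}\rangle$ of $\mathbb{F}_q(t)$ at infinity, put $\deg(\alpha) = -m$. Suppose that $K$ has exactly three $\mathbb{F}_q(t)$-embeddings $\alpha \mapsto \alpha^{(0)}, \alpha^{(1)}, \alpha^{(2)}$ into $\mathbb{F}_q\langle t^{-1}\rangle$, and that $\varepsilon_1, \varepsilon_2$ is a system of fundamental units,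 i.e. every unit of $\mathcal{O}_K$ is $\zeta \varepsilon_1^{a} \varepsilon_2^{b}$ with $\zeta$ a torsion unit and unique $a, b \in \mathbb{Z}$. Then the regulator of $K$ is $$R = \left| \det \begin{pmatrix} \deg(\varepsilon_1^{(i)}) & \deg(\varepsilon_1^{(j)}) \\ \deg(\varepsilon_2^{(i)}) & \deg(\varepsilon_2^{(j)}) \end{pmatrix} \right|, \qquad i \neq j,$$ provided that this does not depend on the choice of $\varepsilon_1, \varepsilon_2$ and of $i \neq j$. Let $A \in \mathbb{F}_q[t]$ with $\deg(A) \geq 1$. 1. Let $b \in \mathbb{F}_q$, $c \in \mathbb{F}_q^*$, and let $K$ be a non-Galois simple cubic function field defined by $x^3 - Ax^2 - (A+b)x - c$. Then the regulator $R$ of $K$ exists (there are three embeddings as above, systems of fundamental units exist, and $R$ does not depend on the choices), and $R \leq \deg(A)^2$. 2. Let $K$ be a Shanks simple cubic function field defined by $x^3 - Ax^2 - (A+3)x - 1$. Then the regulator $R$ of $K$ exists in the same sense, and $R \leq \deg(A)^2$. -/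

import Mathlib

open Polynomial

namespace SimpleCubic

noncomputable section

/-- The polynomial `x³ - A x² - (A + b) x - c` with coefficients in `F[t]`. -/
def simplePoly {F : Type*} [Field F] (A : F[X]) (b c : F) : F[X][X] :=
  X ^ 3 - C A * X ^ 2 - C (A + C b) * X - C (C c)

variable (F K : Type*) [Field F] [Field K] [Algebra F[X] K] [Algebra (RatFunc F) K]

/-- `K = F(t, ε)` where `ε` is a root of the polynomial `f`, irreducible over `F(t)`. -/
def IsDefinedBy (f : F[X][X]) : Prop :=
  Irreducible (f.map (algebraMap F[X] (RatFunc F))) ∧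
    ∃ ε : K, aeval ε f = 0 ∧ IntermediateField.adjoin (RatFunc F) {ε} = ⊤

/-- The maximal order: the integral closure of `F[t]` in `K`. -/
abbrev MaxOrder : Type _ := FunctionField.ringOfIntegers F K

/-- The constants `F` inside the maximal order. -/
def const : F →+* MaxOrder F K :=
  (algebraMap F[X] (MaxOrder F K)).comp (C : F →+* F[X])

/-- The unit rank: the rank of the abelian group of units of the maximal order. -/
def unitRank : ℕ := Module.finrank ℤ (Additive (MaxOrder F K)ˣ)

variable {F K} in
/-- The units `u`, `v` of the maximal order are `k`-exceptional: `v = u + k` with `k ∈ F*`. -/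
def IsExceptionalPair (k : F) (u v : (MaxOrder F K)ˣ) : Prop :=
  k ≠ 0 ∧ (v : MaxOrder F K) = (u : MaxOrder F K) + const F K k

/-- A simple cubic function field: a cubic extension of `F(t)` of unit rank two that has a pair
of `k`-exceptional non-constant units. -/
structure IsSimpleCubicFunctionField : Prop where
  finrank_eq : Module.finrank (RatFunc F) K = 3
  unitRank_eq : unitRank F K = 2
  exists_exceptional : ∃ (k : F) (u v : (MaxOrder F K)ˣ), IsExceptionalPair k u v ∧
    (u : MaxOrder F K) ∉ Set.range (const F K) ∧ (v : MaxOrder F K) ∉ Set.range (const F K)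

/-- A Shanks simple cubic function field: a simple cubic function field Galois over `F(t)`. -/
def IsShanksFunctionField : Prop :=
  IsSimpleCubicFunctionField F K ∧ IsGalois (RatFunc F) K

open Classical in
/-- The field `F((t⁻¹))` of Laurent series, as the completion of `F(t)` at the infinite place. -/
abbrev LaurentInfty : Type _ := RatFunc.CompletionAtInfty F

variable {F} in
/-- The degree on `F((t⁻¹))`: for `α = ∑_{i ≥ m} aᵢ t⁻ⁱ` with `a_m ≠ 0` it is `-m`
(and the junk value `0` at `α = 0`). -/
def deg (α : LaurentInfty F) : ℤ :=
  WithZero.log (Valued.v α)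

/-- The conjugate mappings of `K/F(t)` with values in `F((t⁻¹))`. -/
abbrev Conj : Type _ := K →ₐ[RatFunc F] LaurentInfty F

variable {F K}

/-- `η₁, η₂` is a system of fundamental units (for unit rank two): every unit is
`ζ η₁ᵃ η₂ᵇ` with a torsion unit `ζ` and unique integers `a, b`. -/
def IsFundamentalSystem (η₁ η₂ : (MaxOrder F K)ˣ) : Prop :=
  ∀ u : (MaxOrder F K)ˣ, ∃! n : ℤ × ℤ,
    ∃ ζ : (MaxOrder F K)ˣ, IsOfFinOrder ζ ∧ u = ζ * η₁ ^ n.1 * η₂ ^ n.2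

/-- The matrix of degrees of two conjugates of two units. -/
def degMatrix (η₁ η₂ : (MaxOrder F K)ˣ) (σ τ : Conj F K) : Matrix (Fin 2) (Fin 2) ℤ :=
  !![deg (σ ((η₁ : MaxOrder F K) : K)), deg (τ ((η₁ : MaxOrder F K) : K));
     deg (σ ((η₂ : MaxOrder F K) : K)), deg (τ ((η₂ : MaxOrder F K) : K))]

variable (F K) in
/-- `R` is the regulator of the cubic function field `K`: there are three conjugate mappings into
`F((t⁻¹))`, a system of fundamental units `η₁, η₂` exists, and `R` is the absolute value of the
determinant of the matrix of degrees of the conjugates, for each such system and each choice of two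
distinct conjugate mappings. In particular there is at most one such `R`. -/
structure IsRegulator (R : ℕ) : Prop where
  card_conj : Nat.card (Conj F K) = 3
  exists_fundamental : ∃ η₁ η₂ : (MaxOrder F K)ˣ, IsFundamentalSystem η₁ η₂
  natAbs_det : ∀ η₁ η₂ : (MaxOrder F K)ˣ, IsFundamentalSystem η₁ η₂ →
    ∀ σ τ : Conj F K, σ ≠ τ → (degMatrix η₁ η₂ σ τ).det.natAbs = R

end

end SimpleCubic

/-! Put `d = A.natDegree`. At infinity `f = x³ - Ax² - (A+b)x - c` splits, with one root near `0`,
one near `-1` and one of the size of `A`. The conjugates of a root `ε` thus have degrees `(-d, 0,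
d)`, and those of `ε + 1` have degrees `(0, -d, d)`. Both are units: `c ≠ 0`, and `f(-1) = b - c - 1
≠ 0` by irreducibility. Every 2 × 2 minor of their degrees is `±d²`, so in unit rank two they span a
lattice of finite index modulo torsion. Passing to fundamental units divides all the minors by this
index, which gives `R ∣ d²`. The roots come from `exists_roots`, the lattice argument is
`exists_natAbs_det_eq`, and `exists_isRegulator` joins the two. -/

namespace SimpleCubic

/-! ### Roots over a complete valued field -/

open Valuation in
-- Rank one turns the valuation into a norm, which opens the way to the Banach fixed-point theorem.
lemma nonempty_rankOne {L : Type*} [Field L] [Valued L (WithZero (Multiplicative ℤ))] {a : L}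
    (ha : 1 < Valued.v a) :
    Nonempty (Valuation.RankOne (Valued.v : Valuation L (WithZero (Multiplicative ℤ)))) := by
  have : (Valued.v : Valuation L (WithZero (Multiplicative ℤ))).IsNontrivial :=
    ⟨a, (zero_lt_one.trans ha).ne', ha.ne'⟩
  rw [nonempty_rankOne_iff_mulArchimedean]
  exact MulArchimedean.comap (MonoidWithZeroHom.ValueGroup₀.embedding).toMonoidHom
    MonoidWithZeroHom.ValueGroup₀.embedding_strictMono

/-- The root of small norm of a simple cubic polynomial, as the fixed point of a contraction. -/
lemma exists_small_root_of_norm {L : Type*} [NormedField L] [IsUltrametricDist L] [CompleteSpace L]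
    {a b c : L} (ha : 1 < ‖a‖) (hb : ‖b‖ ≤ 1) (hc : ‖c‖ ≤ 1) :
    ∃ x : L, x ^ 3 - a * x ^ 2 - (a + b) * x - c = 0 ∧ ‖x‖ < 1 := by
  have ha0 : a ≠ 0 := norm_pos_iff.mp (zero_lt_one.trans ha)
  have hr0 : 0 ≤ ‖a⁻¹‖ := norm_nonneg _
  have hr1 : ‖a⁻¹‖ < 1 := by rw [norm_inv]; exact inv_lt_one_of_one_lt₀ ha
  -- The equation divided by `a` and solved for its linear term `x`: fixed points of `φ` are roots.
  let φ : L → L := fun x ↦ (x ^ 3 - b * x - c) * a⁻¹ - x ^ 2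
  let s : Set L := Metric.closedBall 0 ‖a⁻¹‖
  have add_le {x y : L} {r : ℝ} (hx : ‖x‖ ≤ r) (hy : ‖y‖ ≤ r) : ‖x + y‖ ≤ r :=
    (IsUltrametricDist.norm_add_le_max x y).trans (max_le hx hy)
  have sub_le {x y : L} {r : ℝ} (hx : ‖x‖ ≤ r) (hy : ‖y‖ ≤ r) : ‖x - y‖ ≤ r :=
    sub_eq_add_neg x y ▸ add_le hx (by rwa [norm_neg])
  have mul_le {x y : L} {r : ℝ} (hx : ‖x‖ ≤ 1) (hy : ‖y‖ ≤ r) : ‖x * y‖ ≤ r := by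
    rw [norm_mul]
    exact (mul_le_of_le_one_left (norm_nonneg _) hx).trans hy
  have hs : Set.MapsTo φ s s := by
    intro x hx
    have hx : ‖x‖ ≤ ‖a⁻¹‖ := mem_closedBall_zero_iff.mp hx
    have hx1 := hx.trans hr1.le
    refine mem_closedBall_zero_iff.mpr (sub_le (mul_le (sub_le (sub_le ?_ ?_) hc) le_rfl) ?_)
    · rw [norm_pow]; exact pow_le_one₀ (norm_nonneg _) hx1
    · exact mul_le hb hx1
    · rw [pow_two]; exact mul_le hx1 hx
  have hφ : ContractingWith ‖a⁻¹‖₊ (hs.restrict φ s s) := by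
    refine ⟨hr1, LipschitzWith.of_dist_le_mul fun x y ↦ ?_⟩
    have hx : ‖(x : L)‖ ≤ ‖a⁻¹‖ := mem_closedBall_zero_iff.mp x.2
    have hy : ‖(y : L)‖ ≤ ‖a⁻¹‖ := mem_closedBall_zero_iff.mp y.2
    have hx1 := hx.trans hr1.le
    have hy1 := hy.trans hr1.le
    have key : φ x - φ y = ((x ^ 2 + x * y + y ^ 2 - b) * a⁻¹ - (x + y)) * ((x : L) - y) := by
      simp only [φ]; ring
    rw [Subtype.dist_eq, Subtype.dist_eq, dist_eq_norm, dist_eq_norm]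
    change ‖φ x - φ y‖ ≤ _
    rw [key, norm_mul, coe_nnnorm]
    refine mul_le_mul_of_nonneg_right (sub_le (mul_le (sub_le (add_le (add_le ?_ ?_) ?_) hb) le_rfl)
      (add_le hx hy)) (norm_nonneg _)
    · rw [norm_pow]; exact pow_le_one₀ (norm_nonneg _) hx1
    · exact mul_le hx1 hy1
    · rw [norm_pow]; exact pow_le_one₀ (norm_nonneg _) hy1
  obtain ⟨x, hxs, hx, -⟩ := hφ.exists_fixedPoint' Metric.isClosed_closedBall.isComplete hs
    (x := 0) (mem_closedBall_zero_iff.mpr (by simp)) (edist_ne_top _ _)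
  refine ⟨x, ?_, (mem_closedBall_zero_iff.mp hxs).trans_lt hr1⟩
  have hx : (x ^ 3 - b * x - c) * a⁻¹ - x ^ 2 = x := hx
  field_simp at hx
  linear_combination hx

open scoped Valued in
lemma exists_small_root {L : Type*} [Field L] [Valued L (WithZero (Multiplicative ℤ))]
    [CompleteSpace L] {a b c : L} (ha : 1 < Valued.v a) (hb : Valued.v b ≤ 1)
    (hc : Valued.v c ≤ 1) :
    ∃ x : L, x ^ 3 - a * x ^ 2 - (a + b) * x - c = 0 ∧ Valued.v x < 1 := by
  obtain ⟨hv⟩ := nonempty_rankOne ha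
  obtain ⟨x, hx, hx1⟩ := exists_small_root_of_norm
    (Valued.toNormedField.one_lt_norm_iff.mpr ha) (Valued.toNormedField.norm_le_one_iff.mpr hb)
    (Valued.toNormedField.norm_le_one_iff.mpr hc)
  exact ⟨x, hx, Valued.toNormedField.norm_lt_one_iff.mp hx1⟩

/-- The three roots of a simple cubic polynomial over a complete discretely valued field. -/
lemma exists_roots {L : Type*} [Field L] [Valued L (WithZero (Multiplicative ℤ))]
    [CompleteSpace L] {a b c : L} (ha : 1 < Valued.v a) (ha3 : Valued.v (-a - 3) = Valued.v a)
    (hb : Valued.v b ≤ 1) (hc : Valued.v c = 1) (hc' : Valued.v (b - c - 1) = 1) :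
    ∃ r : Fin 3 → L,
      (∀ x, x ^ 3 - a * x ^ 2 - (a + b) * x - c = (x - r 0) * (x - r 1) * (x - r 2)) ∧
      (Valued.v (r 0) = (Valued.v a)⁻¹ ∧ Valued.v (r 1) = 1 ∧ Valued.v (r 2) = Valued.v a) ∧
      (Valued.v (r 0 + 1) = 1 ∧ Valued.v (r 1 + 1) = (Valued.v a)⁻¹ ∧
        Valued.v (r 2 + 1) = Valued.v a) := by
  obtain ⟨x, hx, hxv⟩ := exists_small_root ha hb hc.le
  -- Under `x ↦ -1 - x` the parameters `(a, b, c)` become `(-a - 3, b, b - c - 1)`, so a small root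
  -- `y` here yields the root `-1 - y` near `-1`.
  obtain ⟨y, hy, hyv⟩ := exists_small_root (a := -a - 3) (ha3 ▸ ha) hb hc'.le
  have hx1 : Valued.v (x + 1) = 1 := by
    rw [Valuation.map_add_eq_of_lt_right _ (by simpa using hxv), map_one]
  have hy1 : Valued.v (-1 - y) = 1 := by
    rw [Valuation.map_sub_eq_of_lt_left _ (by simpa using hyv), Valuation.map_neg, map_one]
  have hne : x ≠ -1 - y := fun h ↦ by rw [← h] at hy1; exact hxv.ne hy1
  have hsum : Valued.v (x - 1 - y) ≤ 1 := by
    rw [show x - 1 - y = x + (-1 - y) by ring]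
    exact (Valuation.map_add _ _ _).trans (max_le hxv.le hy1.le)
  -- The third root is `a - x - (-1 - y)`, since the roots sum to `a`.
  have hz : Valued.v (a - x + 1 + y) = Valued.v a := by
    rw [show a - x + 1 + y = a - (x - 1 - y) by ring,
      Valuation.map_sub_eq_of_lt_left _ (hsum.trans_lt ha)]
  have hz1 : Valued.v (a - x + 1 + y + 1) = Valued.v a := by
    rw [Valuation.map_add_eq_of_lt_left _ (by rwa [hz, map_one]), hz]
  have hxy := sub_ne_zero.mpr hne
  have e2 : x * (-1 - y) + (x + (-1 - y)) * (a - x + 1 + y) = -(a + b) := by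
    -- Subtracting the two root equations leaves a multiple of the difference of the roots.
    refine mul_left_cancel₀ hxy ?_
    linear_combination -hx - hy
  have e3 : x * (-1 - y) * (a - x + 1 + y) = c := by
    linear_combination hx + x * e2
  have hfac (t : L) : t ^ 3 - a * t ^ 2 - (a + b) * t - c =
      (t - x) * (t - (-1 - y)) * (t - (a - x + 1 + y)) := by
    linear_combination (-t) * e2 + e3
  have ha0 : Valued.v a ≠ 0 := (zero_lt_one.trans ha).ne'
  refine ⟨![x, -1 - y, a - x + 1 + y], hfac, ⟨?_, hy1, hz⟩, hx1, ?_, hz1⟩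
  · have := congrArg Valued.v e3
    rw [map_mul, map_mul, hy1, hz, hc, mul_one] at this
    exact eq_inv_of_mul_eq_one_left this
  -- The factorization at `-1`, where the cubic takes the value `b - c - 1`.
  · have h1 : (x + 1) * ((-1 - y) + 1) * (a - x + 1 + y + 1) = -(b - c - 1) := by
      linear_combination hfac (-1)
    have := congrArg Valued.v h1
    rw [map_mul, map_mul, hx1, hz1, Valuation.map_neg, hc', one_mul] at this
    exact eq_inv_of_mul_eq_one_left this

/-- The additive form of `IsFundamentalSystem`. -/
def IsAddFundamental {M : Type*} [AddCommGroup M] (η₁ η₂ : M) : Prop :=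
  ∀ u : M, ∃! n : ℤ × ℤ, ∃ ζ : M, IsOfFinAddOrder ζ ∧ u = ζ + n.1 • η₁ + n.2 • η₂

/-! ### Abelian groups of rank two and their minors -/

section Lattice

variable {M : Type*} [AddCommGroup M]

lemma apply_eq_zero_of_isOfFinAddOrder (f : M →ₗ[ℤ] ℤ) {ζ : M} (h : IsOfFinAddOrder ζ) :
    f ζ = 0 := by
  obtain ⟨n, hn, hζ⟩ := isOfFinAddOrder_iff_nsmul_eq_zero.mp h
  have := congrArg f hζ
  rw [map_nsmul, map_zero, nsmul_eq_mul, mul_eq_zero] at this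
  exact this.resolve_left (by exact_mod_cast hn.ne')

/-- Rank two forces a relation between `x`, `y`, `u`. Applying `f` and `g` to it, Cramer's rule
kills the coefficients of `x` and `y`, so a nonzero multiple of `u` vanishes. -/
lemma isOfFinAddOrder_of_apply_eq_zero (hM : Module.finrank ℤ M = 2) {f g : M →ₗ[ℤ] ℤ} {x y : M}
    (hxy : f x * g y - g x * f y ≠ 0) {u : M} (hf : f u = 0) (hg : g u = 0) :
    IsOfFinAddOrder u := by
  have hdep : ¬ LinearIndependent ℤ ![x, y, u] := fun h ↦ by
    have h1 := h.cardinal_lift_le_rank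
    have h2 : Module.rank ℤ M = 2 := by
      rw [Module.finrank, Cardinal.toNat_eq_ofNat] at hM
      exact hM
    rw [h2] at h1
    norm_num at h1
  rw [Fintype.not_linearIndependent_iff] at hdep
  obtain ⟨a, ha, i, hi⟩ := hdep
  simp only [Fin.sum_univ_three, Matrix.cons_val_zero, Matrix.cons_val_one, Matrix.cons_val] at ha
  have h1 := congrArg f ha
  have h2 := congrArg g ha
  simp only [map_add, map_smul, hf, hg, smul_eq_mul, mul_zero, add_zero, map_zero] at h1 h2
  have h0 : a 0 = 0 := (mul_eq_zero.mp (by linear_combination g y * h1 - f y * h2 :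
    a 0 * (f x * g y - g x * f y) = 0)).resolve_right hxy
  have h1' : a 1 = 0 := (mul_eq_zero.mp (by linear_combination f x * h2 - g x * h1 :
    a 1 * (f x * g y - g x * f y) = 0)).resolve_right hxy
  have h2' : a 2 ≠ 0 := by
    intro h
    fin_cases i
    exacts [hi h0, hi h1', hi h]
  rw [h0, h1', zero_smul, zero_smul, zero_add, zero_add] at ha
  exact isOfFinAddOrder_iff_zsmul_eq_zero.mpr ⟨a 2, h2', ha⟩

/-- The image of `(f, g)` in `ℤ²` is free of rank two and the kernel is torsion, so lifts of a basis
of the image form a fundamental system. Finite generation of `M` is not needed. -/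
lemma exists_isAddFundamental (hM : Module.finrank ℤ M = 2) {f g : M →ₗ[ℤ] ℤ} {x y : M}
    (hxy : f x * g y - g x * f y ≠ 0) : ∃ η₁ η₂ : M, IsAddFundamental η₁ η₂ := by
  let D : M →ₗ[ℤ] ℤ × ℤ := f.prod g
  have hli : LinearIndependent ℤ ![D.rangeRestrict x, D.rangeRestrict y] := by
    rw [LinearIndependent.pair_iff]
    intro s t hst
    have h := congrArg Subtype.val hst
    have h1 : s * f x + t * f y = 0 := congrArg Prod.fst h
    have h2 : s * g x + t * g y = 0 := congrArg Prod.snd h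
    exact ⟨(mul_eq_zero.mp (by linear_combination g y * h1 - f y * h2 :
      s * (f x * g y - g x * f y) = 0)).resolve_right hxy,
      (mul_eq_zero.mp (by linear_combination f x * h2 - g x * h1 :
      t * (f x * g y - g x * f y) = 0)).resolve_right hxy⟩
  have hrank : Module.finrank ℤ (LinearMap.range D) = 2 := by
    refine le_antisymm ?_ (by simpa using hli.fintype_card_le_finrank)
    simpa using Submodule.finrank_le (LinearMap.range D)
  let e : Module.Basis (Fin 2) ℤ (LinearMap.range D) := Module.finBasisOfFinrankEq ℤ _ hrank
  obtain ⟨η₁, h1⟩ := (e 0).2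
  obtain ⟨η₂, h2⟩ := (e 1).2
  refine ⟨η₁, η₂, fun u ↦ ?_⟩
  have hker (n : ℤ × ℤ) : (∃ ζ : M, IsOfFinAddOrder ζ ∧ u = ζ + n.1 • η₁ + n.2 • η₂) ↔
      D.rangeRestrict u = n.1 • e 0 + n.2 • e 1 := by
    have hD : D.rangeRestrict u = n.1 • e 0 + n.2 • e 1 ↔ D u = n.1 • D η₁ + n.2 • D η₂ := by
      rw [Subtype.ext_iff, h1, h2]; rfl
    rw [hD]
    constructor
    · rintro ⟨ζ, hζ, rfl⟩
      have : D ζ = 0 := Prod.ext (apply_eq_zero_of_isOfFinAddOrder f hζ)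
        (apply_eq_zero_of_isOfFinAddOrder g hζ)
      rw [map_add, map_add, map_smul, map_smul, this, zero_add]
    · intro h
      have h' : D (u - n.1 • η₁ - n.2 • η₂) = 0 := by
        rw [map_sub, map_sub, map_smul, map_smul, h]; abel
      refine ⟨u - n.1 • η₁ - n.2 • η₂, isOfFinAddOrder_of_apply_eq_zero hM hxy
        (congrArg Prod.fst h') (congrArg Prod.snd h'), by abel⟩
  simp only [hker]
  refine ⟨(e.repr (D.rangeRestrict u) 0, e.repr (D.rangeRestrict u) 1), ?_, ?_⟩
  · exact (e.sum_repr (D.rangeRestrict u)).symm.trans (Fin.sum_univ_two _)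
  · rintro ⟨a, b⟩ h
    rw [h]
    simp

/-- `m` is the determinant of the coordinates of `x`, `y`; it is the same for all `f`, `g`, as these
kill torsion. -/
lemma IsAddFundamental.exists_mul_eq {η₁ η₂ : M} (h : IsAddFundamental η₁ η₂) (x y : M) :
    ∃ m : ℤ, ∀ f g : M →ₗ[ℤ] ℤ,
      f x * g y - g x * f y = m * (f η₁ * g η₂ - g η₁ * f η₂) := by
  obtain ⟨⟨a, b⟩, ⟨ζ, hζ, hx⟩, -⟩ := h x
  obtain ⟨⟨c, d⟩, ⟨ξ, hξ, hy⟩, -⟩ := h y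
  refine ⟨a * d - b * c, fun f g ↦ ?_⟩
  simp only [hx, hy, map_add, map_smul, smul_eq_mul, apply_eq_zero_of_isOfFinAddOrder _ hζ,
    apply_eq_zero_of_isOfFinAddOrder _ hξ]
  ring

lemma exists_natAbs_det_eq (hM : Module.finrank ℤ M = 2) {ι : Type*} (d : ι → M →ₗ[ℤ] ℤ)
    {i j : ι} (hij : i ≠ j) {x y : M} {N : ℕ} (hN : N ≠ 0)
    (h : ∀ i j, i ≠ j → (d i x * d j y - d j x * d i y).natAbs = N) :
    (∃ η₁ η₂ : M, IsAddFundamental η₁ η₂) ∧ ∃ R ≤ N, ∀ η₁ η₂ : M, IsAddFundamental η₁ η₂ →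
      ∀ i j, i ≠ j → (d i η₁ * d j η₂ - d j η₁ * d i η₂).natAbs = R := by
  obtain ⟨η₁, η₂, hη⟩ := exists_isAddFundamental hM (f := d i) (g := d j) (x := x) (y := y)
    (fun h0 ↦ hN (by rw [← h i j hij, h0, Int.natAbs_zero]))
  have hle : (d i η₁ * d j η₂ - d j η₁ * d i η₂).natAbs ≤ N := by
    obtain ⟨m, hm⟩ := hη.exists_mul_eq x y
    refine Nat.le_of_dvd hN.bot_lt ⟨m.natAbs, ?_⟩
    rw [← h i j hij, hm, Int.natAbs_mul, mul_comm]
  refine ⟨⟨η₁, η₂, hη⟩, _, hle, fun θ₁ θ₂ hθ k l hkl ↦ ?_⟩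
  obtain ⟨m, hm⟩ := hθ.exists_mul_eq x y
  obtain ⟨p, hp⟩ := hθ.exists_mul_eq η₁ η₂
  obtain ⟨q, hq⟩ := hη.exists_mul_eq θ₁ θ₂
  have h1 := h i j hij
  have h2 := h k l hkl
  rw [hm, Int.natAbs_mul] at h1 h2
  have hm0 : m.natAbs ≠ 0 := fun h0 ↦ hN (by rw [← h1, h0, zero_mul])
  -- The factor `m` serves both index pairs, so the two minors of `θ₁, θ₂` agree. Comparison with
  -- `η₁, η₂` is then mutual divisibility.
  rw [mul_left_cancel₀ hm0 (h2.trans h1.symm)]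
  refine Nat.dvd_antisymm ⟨p.natAbs, ?_⟩ ⟨q.natAbs, ?_⟩
  · rw [hp, Int.natAbs_mul, mul_comm]
  · rw [hq, Int.natAbs_mul, mul_comm]

end Lattice

/-! ### The degree on the completion at infinity -/

lemma valued_algebraMap {F : Type*} [Field F] (r : RatFunc F) :
    Valued.v (algebraMap (RatFunc F) (LaurentInfty F) r) =
      (open Classical in RatFunc.inftyValuation F r) := by
  classical
  exact @Valued.extensionValuation_apply_coe _ _ _ _ (RatFunc.inftyValued F) r

open Classical in
instance {F : Type*} [Field F] : CompleteSpace (LaurentInfty F) :=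
  @UniformSpace.Completion.completeSpace (RatFunc F) (RatFunc.inftyValued F).toUniformSpace

section Degree

variable {F : Type*} [Field F]

lemma valued_algebraMap_polynomial {p : F[X]} (hp : p ≠ 0) :
    Valued.v (algebraMap (RatFunc F) (LaurentInfty F) (algebraMap F[X] (RatFunc F) p)) =
      WithZero.exp (p.natDegree : ℤ) := by
  classical
  rw [valued_algebraMap, RatFunc.inftyValuation_apply, RatFunc.inftyValuation.polynomial F hp]

lemma deg_mul {x y : LaurentInfty F} (hx : x ≠ 0) (hy : y ≠ 0) : deg (x * y) = deg x + deg y := by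
  rw [deg, map_mul, WithZero.log_mul (by simpa using hx) (by simpa using hy)]
  rfl

lemma deg_one : deg (1 : LaurentInfty F) = 0 := by
  rw [deg, map_one, WithZero.log_one]

end Degree

/-! ### Units and roots of the simple cubic polynomials -/

section SimplePoly

variable {F : Type*} [Field F] (A : F[X]) (b c : F)

lemma aeval_simplePoly {R : Type*} [CommRing R] [Algebra F[X] R] (x : R) :
    aeval x (simplePoly A b c) = x ^ 3 - algebraMap F[X] R A * x ^ 2 -
      (algebraMap F[X] R A + algebraMap F[X] R (C b)) * x - algebraMap F[X] R (C c) := by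
  simp [simplePoly]

lemma monic_simplePoly : (simplePoly A b c).Monic := by
  unfold simplePoly; monicity!

lemma natDegree_simplePoly : (simplePoly A b c).natDegree = 3 := by
  unfold simplePoly; compute_degree!

variable {A b c}

/-- The substitution `x ↦ -1 - x` permutes the simple cubic polynomials. -/
lemma aeval_simplePoly_neg_one_sub {R : Type*} [CommRing R] [Algebra F[X] R] (x : R) :
    aeval (-1 - x) (simplePoly (-A - 3) b (b - c - 1)) = - aeval x (simplePoly A b c) := by
  simp only [aeval_simplePoly, map_sub, map_neg, map_one, map_ofNat]
  ring

/-- Otherwise `-1` would be a root of an irreducible cubic. -/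
lemma sub_sub_one_ne_zero
    (h : Irreducible ((simplePoly A b c).map (algebraMap F[X] (RatFunc F)))) :
    b - c - 1 ≠ 0 := by
  intro h0
  have hroot : ((simplePoly A b c).map (algebraMap F[X] (RatFunc F))).IsRoot (-1) := by
    rw [IsRoot, eval_map_algebraMap, aeval_simplePoly]
    have : algebraMap F[X] (RatFunc F) (C b) =
        algebraMap F[X] (RatFunc F) (C c) + algebraMap F[X] (RatFunc F) 1 := by
      rw [← map_add, ← C_1, ← C_add]; congr 2; linear_combination h0
    rw [this, map_one]; ring
  have := natDegree_eq_of_degree_eq_some (degree_eq_one_of_irreducible_of_root h hroot)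
  rw [(monic_simplePoly A b c).natDegree_map, natDegree_simplePoly] at this
  norm_num at this

/-- The equation exhibits `x` as a divisor of the constant `c`. -/
lemma exists_unit_eq {K : Type*} [Field K] [Algebra F[X] K] (hc : c ≠ 0) {x : K}
    (hx : aeval x (simplePoly A b c) = 0) :
    ∃ u : (MaxOrder F K)ˣ, ((u : MaxOrder F K) : K) = x := by
  let w : MaxOrder F K := ⟨x, simplePoly A b c, monic_simplePoly A b c, hx⟩
  have hw : aeval w (simplePoly A b c) = 0 := by
    apply Subtype.ext
    exact (aeval_algHom_apply (FunctionField.ringOfIntegers F K).val w _).symm.trans hx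
  rw [aeval_simplePoly] at hw
  have hu : IsUnit (w * (w ^ 2 - algebraMap F[X] _ A * w -
      (algebraMap F[X] _ A + algebraMap F[X] _ (C b)))) := by
    rw [show w * (w ^ 2 - algebraMap F[X] _ A * w -
      (algebraMap F[X] _ A + algebraMap F[X] _ (C b))) = algebraMap F[X] (MaxOrder F K) (C c) by
        linear_combination hw]
    exact (isUnit_C.mpr hc.isUnit).map _
  obtain ⟨u, hu⟩ := isUnit_of_mul_isUnit_left hu
  exact ⟨u, congrArg Subtype.val hu⟩

/-- The valuations of the three roots of a simple cubic polynomial in `F((t⁻¹))`. -/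
lemma exists_roots_laurentInfty (hA : 1 ≤ A.natDegree) (hc : c ≠ 0) (hc' : b - c - 1 ≠ 0) :
    ∃ r : Fin 3 → LaurentInfty F,
      (∀ x, aeval x ((simplePoly A b c).map (algebraMap F[X] (RatFunc F))) =
        (x - r 0) * (x - r 1) * (x - r 2)) ∧
      (deg (r 0) = -A.natDegree ∧ deg (r 1) = 0 ∧ deg (r 2) = A.natDegree) ∧
      (deg (r 0 + 1) = 0 ∧ deg (r 1 + 1) = -A.natDegree ∧ deg (r 2 + 1) = A.natDegree) := by
  let φ : F[X] →+* LaurentInfty F :=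
    (algebraMap (RatFunc F) (LaurentInfty F)).comp (algebraMap F[X] (RatFunc F))
  have hφ {p : F[X]} (hp : p ≠ 0) : Valued.v (φ p) = WithZero.exp (p.natDegree : ℤ) :=
    valued_algebraMap_polynomial hp
  have hφC {k : F} (hk : k ≠ 0) : Valued.v (φ (C k)) = 1 := by
    rw [hφ (C_ne_zero.mpr hk), natDegree_C]; rfl
  have hA0 : A ≠ 0 := by rintro rfl; simp at hA
  have hdeg : (-A - 3 : F[X]).natDegree = A.natDegree := by
    rw [show (-A - 3 : F[X]) = -A - C 3 by rw [C_ofNat], natDegree_sub_C, natDegree_neg]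
  have hA3 : (-A - 3 : F[X]) ≠ 0 := by
    intro h; rw [h] at hdeg; simp at hdeg; omega
  have hvA : 1 < Valued.v (φ A) := by
    rw [hφ hA0, ← WithZero.exp_zero, WithZero.exp_lt_exp]; omega
  have hvA3 : Valued.v (-φ A - 3) = Valued.v (φ A) := by
    rw [hφ hA0, ← hdeg, ← hφ hA3, map_sub φ, map_neg φ, map_ofNat φ 3]
  have hvb : Valued.v (φ (C b)) ≤ 1 := by
    rcases eq_or_ne b 0 with rfl | hb
    · simp
    · exact (hφC hb).le
  have hvc' : Valued.v (φ (C b) - φ (C c) - 1) = 1 := by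
    rw [← hφC hc']; simp
  obtain ⟨r, hr, h, h'⟩ := exists_roots hvA hvA3 hvb (hφC hc) hvc'
  rw [hφ hA0] at h h'
  refine ⟨r, fun x ↦ ?_, ?_, ?_⟩
  · rw [← hr]
    simp [simplePoly, φ]
  · simp [deg, h]
  · simp [deg, h']

end SimplePoly

/-! ### Conjugate mappings and the regulator -/

section Conj

variable {F K : Type*} [Field F] [Field K] [Algebra (RatFunc F) K]

/-- The conjugate mappings correspond to the roots of the minimal polynomial of a generator. -/
lemma exists_conj_equiv {g : (RatFunc F)[X]} (hg : Irreducible g) (hm : g.Monic) {ε : K}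
    (hε : aeval ε g = 0) (htop : IntermediateField.adjoin (RatFunc F) {ε} = ⊤)
    {ι : Type*} {r : ι → LaurentInfty F} (hr : Function.Injective r)
    (hroot : ∀ x, aeval x g = 0 ↔ x ∈ Set.range r) :
    ∃ e : ι ≃ Conj F K, ∀ i, e i ε = r i := by
  have hmin : g = minpoly (RatFunc F) ε := minpoly.eq_of_irreducible_of_monic hg hε hm
  let pb : PowerBasis (RatFunc F) K :=
    (IntermediateField.adjoin.powerBasis (⟨g, hm, hε⟩ : IsIntegral (RatFunc F) ε)).map
      ((IntermediateField.equivOfEq htop).trans IntermediateField.topEquiv)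
  have hgen : pb.gen = ε := rfl
  have hex (i : ι) : ∃ σ : Conj F K, σ ε = r i := by
    have h : aeval (r i) (minpoly (RatFunc F) pb.gen) = 0 := by
      rw [hgen, ← hmin]; exact (hroot _).mpr ⟨i, rfl⟩
    exact ⟨pb.lift (r i) h, pb.lift_gen (r i) h⟩
  choose e he using hex
  refine ⟨Equiv.ofBijective e ⟨fun i j hij ↦ hr ?_, fun σ ↦ ?_⟩, he⟩
  · rw [← he, ← he, hij]
  · obtain ⟨i, hi⟩ := (hroot (σ ε)).mp (by rw [aeval_algHom_apply, hε, map_zero])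
    exact ⟨i, pb.algHom_ext ((he i).trans hi)⟩

variable [Algebra F[X] K]

/-- The degree of a conjugate, as a homomorphism on the group of units. -/
noncomputable def degHom (σ : Conj F K) : Additive (MaxOrder F K)ˣ →ₗ[ℤ] ℤ :=
  AddMonoidHom.toIntLinearMap
    { toFun := fun u ↦ deg (σ ((u.toMul : MaxOrder F K) : K))
      map_zero' := by simp [deg_one]
      map_add' := fun u v ↦ by
        have h (w : (MaxOrder F K)ˣ) : σ ((w : MaxOrder F K) : K) ≠ 0 := by
          exact (_root_.map_ne_zero σ).mpr fun h ↦ w.ne_zero (Subtype.ext h)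
        rw [toMul_add, Units.val_mul, MulMemClass.coe_mul, map_mul, deg_mul (h _) (h _)] }

lemma det_degMatrix (η₁ η₂ : (MaxOrder F K)ˣ) (σ τ : Conj F K) :
    (degMatrix η₁ η₂ σ τ).det =
      degHom σ (Additive.ofMul η₁) * degHom τ (Additive.ofMul η₂) -
        degHom τ (Additive.ofMul η₁) * degHom σ (Additive.ofMul η₂) := by
  rw [degMatrix, Matrix.det_fin_two_of]
  rfl

theorem exists_isRegulator [IsScalarTower F[X] (RatFunc F) K] {A : F[X]} (hA : 1 ≤ A.natDegree)
    {b c : F} (hc : c ≠ 0) (hK : unitRank F K = 2) (hf : IsDefinedBy F K (simplePoly A b c)) :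
    ∃ R : ℕ, IsRegulator F K R ∧ R ≤ A.natDegree ^ 2 := by
  obtain ⟨hirr, ε, hε, htop⟩ := hf
  have hc' := sub_sub_one_ne_zero hirr
  obtain ⟨r, hr, ⟨d0, d1, d2⟩, d0', d1', d2'⟩ := exists_roots_laurentInfty hA hc hc'
  have hinj : Function.Injective r := by
    intro i j hij
    have h := congrArg deg hij
    -- The degrees `-d, 0, d` are distinct because `d ≥ 1`.
    fin_cases i <;> fin_cases j <;> first | rfl | (simp [d0, d1, d2] at h; omega)
  obtain ⟨e, he⟩ := exists_conj_equiv hirr ((monic_simplePoly A b c).map _)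
    (by rwa [aeval_map_algebraMap]) htop hinj (fun x ↦ by
      rw [hr, mul_eq_zero, mul_eq_zero, sub_eq_zero, sub_eq_zero, sub_eq_zero, Set.mem_range,
        Fin.exists_fin_succ, Fin.exists_fin_two]
      simp only [eq_comm, or_assoc]; rfl)
  obtain ⟨u, hu⟩ := exists_unit_eq hc hε
  -- The unit `-1 - ε` replaces `ε + 1`: it is a root of the substituted polynomial, and the sign
  -- does not affect degrees.
  obtain ⟨w, hw⟩ := exists_unit_eq (x := -1 - ε) hc'
    (by rw [aeval_simplePoly_neg_one_sub, hε, neg_zero])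
  have hdu (i : Fin 3) : degHom (e i) (Additive.ofMul u) = deg (r i) := by
    rw [← he, ← hu]; rfl
  have hdw (i : Fin 3) : degHom (e i) (Additive.ofMul w) = deg (r i + 1) := by
    have : degHom (e i) (Additive.ofMul w) = deg (e i ((w : MaxOrder F K) : K)) := rfl
    rw [this, hw, map_sub, map_neg, map_one, he, deg, deg, ← Valuation.map_neg]
    congr 2; ring
  obtain ⟨⟨η₁, η₂, hη⟩, R, hR, hdet⟩ := exists_natAbs_det_eq hK (fun i ↦ degHom (e i))
    (i := 0) (j := 1) (by decide) (x := Additive.ofMul u) (y := Additive.ofMul w)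
    (N := A.natDegree ^ 2) (by positivity) (fun i j hij ↦ by
      simp only [hdu, hdw]
      fin_cases i <;> fin_cases j <;>
        first
        | exact absurd rfl hij
        | simp [d0, d1, d2, d0', d1', d2', Int.natAbs_mul, pow_two])
  refine ⟨R, ⟨?_, ⟨η₁.toMul, η₂.toMul, hη⟩, fun θ₁ θ₂ hθ σ τ hστ ↦ ?_⟩, hR⟩
  · rw [← Nat.card_congr e, Nat.card_fin]
  · obtain ⟨i, rfl⟩ := e.surjective σ
    obtain ⟨j, rfl⟩ := e.surjective τ
    rw [det_degMatrix]
    exact hdet _ _ hθ i j fun h ↦ hστ (congrArg e h)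

end Conj

end SimpleCubic

theorem mainTheorem7 {F : Type*} [Field F] [Finite F] (hchar : 5 ≤ ringChar F)
    {K : Type*} [Field K] [Algebra F[X] K] [Algebra (RatFunc F) K]
    [IsScalarTower F[X] (RatFunc F) K] (A : F[X]) (hA : 1 ≤ A.natDegree) :
    (∀ b c : F, c ≠ 0 →
      SimpleCubic.IsSimpleCubicFunctionField F K → ¬ IsGalois (RatFunc F) K →
      SimpleCubic.IsDefinedBy F K (SimpleCubic.simplePoly A b c) →
        ∃ R : ℕ, SimpleCubic.IsRegulator F K R ∧ R ≤ A.natDegree ^ 2) ∧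
    (SimpleCubic.IsShanksFunctionField F K →
      SimpleCubic.IsDefinedBy F K (SimpleCubic.simplePoly A 3 1) →
        ∃ R : ℕ, SimpleCubic.IsRegulator F K R ∧ R ≤ A.natDegree ^ 2) := by
  refine ⟨fun b c hc hK _ hf ↦ SimpleCubic.exists_isRegulator hA hc hK.unitRank_eq hf,
    fun hK hf ↦ SimpleCubic.exists_isRegulator hA one_ne_zero hK.1.unitRank_eq hf⟩
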